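/- Let $p\ge 1$, let $\theta=(\theta_1,\dots,\theta_p)'\in\mathbb R^p$ be nonzero with $\|\theta\|_1=\sum_{i=1}^p|\theta_i|<1$, and let $|\rho|<1$. Let $(V_n)_{n\ge1}$ be independent, identically distributed, square-integrable real random variables with mean $0$ and variance $\sigma^2>0$. Let $X_0=\varepsilon_0$ be a square-integrable random variable, let $X_{-1}=\dots=X_{-p}=0$ and, for all $n\ge1$, $$X_n=\theta_1X_{n-1}+\dots+\theta_pX_{n-p}+\varepsilon_n,\qquad \varepsilon_n=\rho\,\varepsilon_{n-1}+V_n .$$ For $n\ge 0$ put $\Phi_n=(X_n,X_{n-1},\dots,X_{n-p+1})'$ and $S_n=\sum_{k=0}^n\Phi_k\Phi_k'+S$, where $S$ is a fixed symmetric positive definite $p\times p$ matrix. For $n\ge1$ let $$\widehat\theta_n=S_{n-1}^{-1}\sum_{k=1}^n\Phi_{k-1}X_k,\qquad \widehat\varepsilon_0=X_0,\qquad \widehat\varepsilon_k=X_k-\widehat\theta_n'\,\Phi_{k-1}\quad(1\le k\le n),$$ $$\widehat\rho_n=\Bigl(\sum_{k=1}^n\widehat\varepsilon_{k-1}^{\,2}\Bigr)^{-1}\sum_{k=1}^n\widehat\varepsilon_k\,\widehat\varepsilon_{k-1}.$$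 Let $I_p$ be the identity matrix, let $J_p$ be the exchange matrix of order $p$ (ones on the antidiagonal, zeros elsewhere), and let $$\alpha=\frac1{(1-\theta_p\rho)(1+\theta_p\rho)},\qquad \beta=(\theta_1+\rho,\ \theta_2-\theta_1\rho,\ \dots,\ \theta_p-\theta_{p-1}\rho)',\qquad \theta^*=\alpha\,(I_p-\theta_p\rho J_p)\,\beta .$$ Then, almost surely, $$\lim_{n\to\infty}\widehat\rho_n=\rho^*:=\theta_p\,\rho\,\theta^*_p,$$ where $\theta^*_p$ is the $p$-th component of $\theta^*$. -/

import Mathlib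

open MeasureTheory ProbabilityTheory Filter Topology Matrix

/-- Last coordinate `v_p` of a vector `(v_1, …, v_p)`, `p ≥ 1` (coordinates are numbered from `0`
in `Fin p`). -/
def lastCoord {p : ℕ} (hp : 0 < p) (v : Fin p → ℝ) : ℝ :=
  v ⟨p - 1, by omega⟩

/-- The exchange matrix `J_p`, with ones on the antidiagonal. -/
def exchangeMatrix (p : ℕ) : Matrix (Fin p) (Fin p) ℝ :=
  Matrix.of fun i j => if i = Fin.rev j then 1 else 0

noncomputable section

/-- `α = 1 / ((1 - θ_p ρ) (1 + θ_p ρ))`. -/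
def alphaCoef {p : ℕ} (hp : 0 < p) (θ : Fin p → ℝ) (ρ : ℝ) : ℝ :=
  1 / ((1 - lastCoord hp θ * ρ) * (1 + lastCoord hp θ * ρ))

/-- `β = (θ_1 + ρ, θ_2 - θ_1 ρ, …, θ_p - θ_{p-1} ρ)`. -/
def betaVec {p : ℕ} (θ : Fin p → ℝ) (ρ : ℝ) : Fin p → ℝ := fun i =>
  if (i : ℕ) = 0 then θ i + ρ else θ i - θ ⟨(i : ℕ) - 1, by omega⟩ * ρ

/-- `θ* = α (I_p - θ_p ρ J_p) β`. -/
def thetaStar {p : ℕ} (hp : 0 < p) (θ : Fin p → ℝ) (ρ : ℝ) : Fin p → ℝ :=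
  alphaCoef hp θ ρ •
    ((1 - (lastCoord hp θ * ρ) • exchangeMatrix p : Matrix (Fin p) (Fin p) ℝ) *ᵥ betaVec θ ρ)

/-- `ρ* = θ_p ρ θ*_p`. -/
def rhoStar {p : ℕ} (hp : 0 < p) (θ : Fin p → ℝ) (ρ : ℝ) : ℝ :=
  lastCoord hp θ * ρ * lastCoord hp (thetaStar hp θ ρ)

/-- Lag vector `Φ_n = (x_n, x_{n-1}, …, x_{n-p+1})` of a path `x`. -/
def lagVec (p : ℕ) (x : ℤ → ℝ) (n : ℤ) : Fin p → ℝ := fun i => x (n - (i : ℤ))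

/-- `S_n = ∑_{k=0}^n Φ_k Φ_k' + S`. -/
def designMatrix {p : ℕ} (S : Matrix (Fin p) (Fin p) ℝ) (x : ℤ → ℝ) (n : ℕ) :
    Matrix (Fin p) (Fin p) ℝ :=
  ∑ k ∈ Finset.range (n + 1), vecMulVec (lagVec p x k) (lagVec p x k) + S

/-- Least squares estimator `θ̂_n = S_{n-1}⁻¹ ∑_{k=1}^n Φ_{k-1} x_k` of `θ`, for `n ≥ 1`. -/
def thetaHat {p : ℕ} (S : Matrix (Fin p) (Fin p) ℝ) (x : ℤ → ℝ) (n : ℕ) : Fin p → ℝ :=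
  (designMatrix S x (n - 1))⁻¹ *ᵥ
    ∑ k ∈ Finset.Icc 1 n, x (k : ℤ) • lagVec p x ((k : ℤ) - 1)

/-- Residuals at stage `n`: `ε̂_0 = x_0` and `ε̂_k = x_k - θ̂_n' Φ_{k-1}` for `k ≥ 1`. -/
def estResidual {p : ℕ} (S : Matrix (Fin p) (Fin p) ℝ) (x : ℤ → ℝ) (n k : ℕ) : ℝ :=
  if k = 0 then x 0 else x (k : ℤ) - thetaHat S x n ⬝ᵥ lagVec p x ((k : ℤ) - 1)

/-- Least squares estimator `ρ̂_n = (∑_{k=1}^n ε̂_{k-1}²)⁻¹ ∑_{k=1}^n ε̂_k ε̂_{k-1}` of `ρ`,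
for `n ≥ 1`. -/
def rhoHat {p : ℕ} (S : Matrix (Fin p) (Fin p) ℝ) (x : ℤ → ℝ) (n : ℕ) : ℝ :=
  (∑ k ∈ Finset.Icc 1 n, estResidual S x n (k - 1) ^ 2)⁻¹ *
    ∑ k ∈ Finset.Icc 1 n, estResidual S x n k * estResidual S x n (k - 1)

end

/-! Probability enters only through the strong law: almost surely the averages of `V_k²` tend to
`σ²` and those of `V_{k+j} V_k`, `j ≥ 1`, to `0`. The rest is pathwise. Contractivity of the two
recursions carries quadratic bounds from the noise `v` to `ε` and `X`, so along any ultrafilter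
finer than `atTop` all empirical covariances of lags converge. The limits form a positive
semidefinite bilinear form `limCov`, invariant under shifts, for which the lags satisfy the
relations of a stationary autoregression (`IsStationaryAR`; a larger index lies further in the
past).

Inside this structure the answer is algebra. Put `t = θ_p ρ`. Eliminating the innovation gives an
AR(p+1) recursion with coefficients `β` and `-t`. With `Γ` the Gram matrix of `p` lags and `c` the
covariances of the present with them, time reversal gives `c + t J c = Γ β`. As `β = (I + t J) θ*`
and `Γ` commutes with `J`, it follows that `Γ θ* = c` (`yule_walker`); `Γ` is invertible, hence
`θ̂_n → θ*`. The limiting residual `z` is orthogonal to the last `p` values, and its covariance with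
the value `p+1` steps back is `-t ⟨z, z⟩`, so its lag-one autocovariance is `t θ*_p ⟨z, z⟩ = ρ* ⟨z,
z⟩`, with `⟨z, z⟩ ≥ σ² > 0`. The limit is the same along every ultrafilter, so the full sequence
converges. -/

/-- A bounded two-sided sequence solving a contractive forward recursion at positive times vanishes
at positive times. -/
theorem eq_zero_of_contractive_recursion {q : ℕ} (a : Fin q → ℝ) (ha : ∑ i, |a i| < 1)
    (g : ℤ → ℝ) (C : ℝ) (hC : ∀ j, |g j| ≤ C)
    (hg : ∀ j : ℤ, 0 < j → g j = ∑ i : Fin q, a i * g (j + i + 1)) (j : ℤ) (hj : 0 < j) :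
    g j = 0 := by
  have key : ∀ m : ℕ, ∀ j : ℤ, 0 < j → |g j| ≤ (∑ i, |a i|) ^ m * C := by
    intro m
    induction m with
    | zero => intro j _; simpa using hC j
    | succ m ih =>
      intro j hj
      rw [hg j hj]
      calc |∑ i : Fin q, a i * g (j + i + 1)| ≤ ∑ i : Fin q, |a i * g (j + i + 1)| :=
            Finset.abs_sum_le_sum_abs _ _
        _ ≤ ∑ i : Fin q, |a i| * ((∑ i, |a i|) ^ m * C) := by
            refine Finset.sum_le_sum fun i _ => ?_
            rw [abs_mul]
            exact mul_le_mul_of_nonneg_left (ih _ (by omega)) (abs_nonneg _)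
        _ = (∑ i, |a i|) ^ (m + 1) * C := by rw [← Finset.sum_mul]; ring
  have hlim : Tendsto (fun m : ℕ => (∑ i, |a i|) ^ m * C) atTop (𝓝 0) := by
    simpa using (tendsto_pow_atTop_nhds_zero_of_lt_one
      (Finset.sum_nonneg fun i _ => abs_nonneg (a i)) ha).mul_const C
  have := ge_of_tendsto' hlim fun m => key m j hj
  exact abs_nonpos_iff.mp this

/-! ### Algebra of `β` and `θ*` -/

/-- With `L` the lag operator, `1 - β_1 L - … - β_p L^p + θ_p ρ L^{p+1}` is the product `(1 - ρ L)(1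
- θ_1 L - … - θ_p L^p)`; the last term here compensates for the coefficient of order `p+1`. -/
theorem sum_betaVec_mul {p : ℕ} (hp : 0 < p) (θ : Fin p → ℝ) (ρ : ℝ) (f : ℕ → ℝ) :
    ∑ i : Fin p, betaVec θ ρ i * f i =
      ρ * f 0 + ∑ i : Fin p, θ i * f i - ρ * ∑ i : Fin p, θ i * f (i + 1)
        + lastCoord hp θ * ρ * f p := by
  obtain ⟨m, rfl⟩ : ∃ m, p = m + 1 := ⟨p - 1, by omega⟩
  have h1 : ∀ i : Fin m, betaVec θ ρ i.succ = θ i.succ - θ i.castSucc * ρ := by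
    intro i
    simp only [betaVec, Fin.val_succ, Nat.succ_ne_zero, if_false]
    congr 3
  have h0 : betaVec θ ρ 0 = θ 0 + ρ := by simp [betaVec]
  have hl : lastCoord hp θ = θ (Fin.last m) := rfl
  rw [Fin.sum_univ_succ (f := fun i => betaVec θ ρ i * f i),
    Fin.sum_univ_succ (f := fun i => θ i * f i),
    Fin.sum_univ_castSucc (f := fun i => θ i * f (i + 1)), h0, hl]
  simp only [h1, sub_mul, Finset.sum_sub_distrib, Fin.val_succ, Fin.val_castSucc, Fin.val_last,
    Fin.val_zero, mul_add, Finset.mul_sum]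
  have : ∑ i : Fin m, θ i.castSucc * ρ * f (i + 1) = ∑ i : Fin m, ρ * (θ i.castSucc * f (i + 1)) :=
    Finset.sum_congr rfl fun i _ => by ring
  rw [this]
  ring

theorem exchangeMatrix_mulVec {p : ℕ} (a : Fin p → ℝ) (i : Fin p) :
    (exchangeMatrix p *ᵥ a) i = a i.rev := by
  simp only [exchangeMatrix, mulVec, dotProduct, of_apply]
  rw [Finset.sum_eq_single i.rev]
  · simp
  · intro j _ hj
    rw [if_neg (fun h => hj (by rw [h, Fin.rev_rev])), zero_mul]
  · simp

theorem thetaStar_apply {p : ℕ} (hp : 0 < p) (θ : Fin p → ℝ) (ρ : ℝ) (i : Fin p) :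
    thetaStar hp θ ρ i =
      alphaCoef hp θ ρ * (betaVec θ ρ i - lastCoord hp θ * ρ * betaVec θ ρ i.rev) := by
  simp [thetaStar, sub_mulVec, smul_mulVec, exchangeMatrix_mulVec]

/-- Since `J² = I`, the matrix `α (I - t J)` is the inverse of `I + t J`, where `t = θ_p ρ`. -/
theorem thetaStar_add_rev {p : ℕ} (hp : 0 < p) (θ : Fin p → ℝ) (ρ : ℝ)
    (ht : |lastCoord hp θ * ρ| < 1) (i : Fin p) :
    thetaStar hp θ ρ i + lastCoord hp θ * ρ * thetaStar hp θ ρ i.rev = betaVec θ ρ i := by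
  rw [thetaStar_apply, thetaStar_apply, Fin.rev_rev, alphaCoef]
  obtain ⟨h1, h2⟩ := abs_lt.mp ht
  have : (1 - lastCoord hp θ * ρ) ≠ 0 := by linarith
  have : (1 + lastCoord hp θ * ρ) ≠ 0 := by linarith
  field_simp
  ring

theorem abs_lastCoord_mul_lt_one {p : ℕ} (hp : 0 < p) (θ : Fin p → ℝ) (ρ : ℝ)
    (hθ : ∑ i, |θ i| < 1) (hρ : |ρ| < 1) : |lastCoord hp θ * ρ| < 1 := by
  have h : |lastCoord hp θ| ≤ ∑ i, |θ i| :=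
    Finset.single_le_sum (f := fun i => |θ i|) (fun i _ => abs_nonneg _) (Finset.mem_univ _)
  rw [abs_mul]
  exact mul_lt_one_of_nonneg_of_lt_one_left (abs_nonneg _) (h.trans_lt hθ) hρ.le

/-! ### Second-order theory of the stationary model -/

/-- Second-order structure of a stationary autoregressive process whose innovations are themselves
first-order autoregressive, with respect to a semi-inner product `B`; the vectors `x j`, `e j`,
`v j` stand for the `j`-th lags of the process, its innovation and the driving noise. -/
structure IsStationaryAR {H : Type*} [AddCommGroup H] [Module ℝ H] {p : ℕ} (θ : Fin p → ℝ)
    (ρ σ : ℝ) (B : H →ₗ[ℝ] H →ₗ[ℝ] ℝ) (x e v : ℤ → H) : Prop where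
  symm : ∀ f g, B f g = B g f
  nonneg : ∀ f, 0 ≤ B f f
  shift_x : ∀ m i j, B (x (i + m)) (x (j + m)) = B (x i) (x j)
  shift_e : ∀ m i j, B (e (i + m)) (e (j + m)) = B (e i) (e j)
  shift_vx : ∀ m i j, B (v (i + m)) (x (j + m)) = B (v i) (x j)
  var_v : B (v 0) (v 0) = σ ^ 2
  orth_v : ∀ j, 0 < j → B (v 0) (v j) = 0
  rec_x : ∀ j g, B (x j) g = ∑ i : Fin p, θ i * B (x (j + i + 1)) g + B (e j) g
  rec_e : ∀ j g, B (e j) g = ρ * B (e (j + 1)) g + B (v j) g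

namespace IsStationaryAR

variable {H : Type*} [AddCommGroup H] [Module ℝ H] {p : ℕ} {θ : Fin p → ℝ}
  {ρ σ : ℝ} {B : H →ₗ[ℝ] H →ₗ[ℝ] ℝ} {x e v : ℤ → H}

theorem abs_le (h : IsStationaryAR θ ρ σ B x e v) (f g : H) :
    |B f g| ≤ (B f f + B g g) / 2 := by
  have h1 := h.nonneg (f + g)
  have h2 := h.nonneg (f - g)
  simp only [map_add, map_sub, LinearMap.add_apply, LinearMap.sub_apply] at h1 h2
  rw [h.symm g f] at h1 h2
  rw [_root_.abs_le]
  constructor <;> linarith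

/-- For `j > 0` the recursion gives `B (v 0) (e j) = ρ * B (v 0) (e (j + 1))`, and stationarity
bounds these numbers uniformly in `j`. -/
theorem orth_ve (h : IsStationaryAR θ ρ σ B x e v) (hρ : |ρ| < 1) (j : ℤ) (hj : 0 < j) :
    B (v 0) (e j) = 0 := by
  refine eq_zero_of_contractive_recursion (fun _ : Fin 1 => ρ) (by simpa using hρ)
    (fun j => B (v 0) (e j)) ((B (v 0) (v 0) + B (e 0) (e 0)) / 2) (fun j => ?_)
    (fun j hj => ?_) j hj
  · have := h.shift_e j 0 0
    rw [zero_add] at this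
    rw [← this]
    exact h.abs_le _ _
  · simp only [Finset.univ_unique, Fin.default_eq_zero, Fin.val_zero, Finset.sum_singleton,
      Nat.cast_zero, add_zero]
    rw [h.symm, h.rec_e, h.symm (v j), h.orth_v j hj, h.symm (v 0), add_zero]

theorem orth_vx_zero (h : IsStationaryAR θ ρ σ B x e v) (hθ : ∑ i, |θ i| < 1) (hρ : |ρ| < 1)
    (j : ℤ) (hj : 0 < j) : B (v 0) (x j) = 0 := by
  refine eq_zero_of_contractive_recursion θ hθ
    (fun j => B (v 0) (x j)) ((B (v 0) (v 0) + B (x 0) (x 0)) / 2) (fun j => ?_)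
    (fun j hj => ?_) j hj
  · have := h.shift_x j 0 0
    rw [zero_add] at this
    rw [← this]
    exact h.abs_le _ _
  · rw [h.symm, h.rec_x, h.symm (e j), h.orth_ve hρ j hj, add_zero]
    simp only [h.symm (v 0)]

theorem orth_vx (h : IsStationaryAR θ ρ σ B x e v) (hθ : ∑ i, |θ i| < 1) (hρ : |ρ| < 1)
    (i j : ℤ) (hij : i < j) : B (v i) (x j) = 0 := by
  have := h.shift_vx i 0 (j - i)
  rw [zero_add, sub_add_cancel] at this
  rw [this, h.orth_vx_zero hθ hρ _ (by omega)]

theorem cov_vx (h : IsStationaryAR θ ρ σ B x e v) (hθ : ∑ i, |θ i| < 1) (hρ : |ρ| < 1)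
    (i : ℤ) : B (v i) (x i) = σ ^ 2 := by
  have := h.shift_vx i 0 0
  rw [zero_add] at this
  rw [this, h.symm, h.rec_x, h.rec_e, h.symm (e _), h.orth_ve hρ _ (by norm_num), h.var_v,
    Finset.sum_eq_zero fun i _ => ?_]
  · ring
  · rw [h.symm, h.orth_vx_zero hθ hρ _ (by positivity), mul_zero]

theorem reflect (h : IsStationaryAR θ ρ σ B x e v) (i j i' j' : ℤ) (hij : i + i' = j + j') :
    B (x i) (x j) = B (x i') (x j') := by
  have := h.shift_x (j - i') i' j'
  rw [add_sub_cancel, show j' + (j - i') = i by omega] at this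
  rw [← this, h.symm]

theorem rec_ar (h : IsStationaryAR θ ρ σ B x e v) (hp : 0 < p) (g : H) :
    B (x 0) g = ∑ i : Fin p, betaVec θ ρ i * B (x (i + 1)) g
      - lastCoord hp θ * ρ * B (x (p + 1)) g + B (v 0) g := by
  have hb := sum_betaVec_mul hp θ ρ (fun i => B (x (i + 1)) g)
  rw [hb]
  have h0 := h.rec_x 0 g
  have h1 := h.rec_x 1 g
  have h2 := h.rec_e 0 g
  simp only [zero_add] at h0 h1 h2
  have : ∑ i : Fin p, θ i * B (x (((i : ℕ) + 1 : ℕ) + 1)) g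
      = ∑ i : Fin p, θ i * B (x (1 + i + 1)) g :=
    Finset.sum_congr rfl fun i _ => by push_cast; rw [add_comm (1 : ℤ)]
  rw [this]
  simp only [Nat.cast_zero, zero_add]
  linear_combination h0 + h2 - ρ * h1

/-- A kernel vector gives an isotropic combination of lags, which a semidefinite form pairs to zero
with everything. Pairing with the noise lags gives a triangular system for `a` with diagonal `σ²`.
-/
theorem eq_zero_of_mulVec_eq_zero (h : IsStationaryAR θ ρ σ B x e v) (hθ : ∑ i, |θ i| < 1)
    (hρ : |ρ| < 1) (hσ : 0 < σ) (a : Fin p → ℝ)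
    (ha : ∀ i : Fin p, ∑ j : Fin p, B (x (i + 1)) (x (j + 1)) * a j = 0) : a = 0 := by
  set y : H := ∑ j : Fin p, a j • x (j + 1) with hy
  have hyy : B y y = 0 := by
    have : ∀ i : Fin p, B (x (i + 1)) y = 0 := by
      intro i
      rw [← ha i, hy]
      simp [mul_comm]
    nth_rw 1 [hy]
    simp [this]
  have hvy : ∀ u, B u y = 0 := by
    intro u
    by_contra hne
    have key : ∀ s : ℝ, 0 ≤ B u u - 2 * s * B u y := by
      intro s
      have := h.nonneg (u - s • y)
      simp only [map_sub, LinearMap.sub_apply, map_smul, LinearMap.smul_apply, smul_eq_mul,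
        h.symm y u, hyy] at this
      linarith
    -- This `s` makes the right-hand side of `key` equal to `-1`.
    have := key ((B u u + 1) / (2 * B u y))
    have h2 : 2 * ((B u u + 1) / (2 * B u y)) * B u y = B u u + 1 := by field_simp
    linarith
  have main : ∀ m : ℕ, ∀ i : Fin p, (i : ℕ) = m → a i = 0 := by
    intro m
    induction m using Nat.strong_induction_on with
    | _ m ih =>
      intro i hi
      have := hvy (v (i + 1))
      rw [hy] at this
      simp only [map_sum, map_smul, smul_eq_mul] at this
      rw [Finset.sum_eq_single i] at this
      · rw [h.cov_vx hθ hρ] at this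
        have hs : σ ^ 2 ≠ 0 := by positivity
        exact (mul_eq_zero.mp this).resolve_right hs
      · intro j _ hj
        rcases lt_or_gt_of_ne (fun hh => hj (Fin.ext hh) : (j : ℕ) ≠ i) with hlt | hgt
        · rw [ih j (by omega) j rfl, zero_mul]
        · rw [h.orth_vx hθ hρ _ _ (by omega), mul_zero]
      · simp
  funext i
  exact main i i rfl

/-- Both sides, as vectors in `i`, have the same image under `I + t J`, which is injective because
`|t| < 1`. The equality of images combines `rec_ar` with the invariance of covariances under time
reversal. -/
theorem yule_walker (h : IsStationaryAR θ ρ σ B x e v) (hp : 0 < p) (hθ : ∑ i, |θ i| < 1)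
    (hρ : |ρ| < 1) (i : Fin p) :
    ∑ j : Fin p, thetaStar hp θ ρ j * B (x (j + 1)) (x (i + 1)) = B (x 0) (x (i + 1)) := by
  set t := lastCoord hp θ * ρ with ht
  have htlt : |t| < 1 := abs_lastCoord_mul_lt_one hp θ ρ hθ hρ
  set u : Fin p → ℝ := fun i => ∑ j : Fin p, thetaStar hp θ ρ j * B (x (j + 1)) (x (i + 1)) with hu
  have hrev : ∀ i : Fin p, (((i.rev : Fin p) : ℕ) : ℤ) = p - 1 - i := by
    intro i
    rw [Fin.val_rev]
    omega
  have hrec : ∀ i : Fin p,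
      B (x 0) (x (i + 1)) + t * B (x 0) (x (i.rev + 1)) = u i + t * u i.rev := by
    intro i
    have h1 := h.rec_ar hp (x (i + 1))
    rw [h.symm (v 0), h.symm _ (v 0), h.orth_vx hθ hρ _ _ (by positivity), add_zero] at h1
    have h2 : B (x (p + 1)) (x (i + 1)) = B (x 0) (x (i.rev + 1)) := by
      apply h.reflect
      rw [hrev]
      ring
    have h3 : u i.rev = ∑ j : Fin p, thetaStar hp θ ρ j.rev * B (x (j + 1)) (x (i + 1)) := by
      rw [hu, ← Equiv.sum_comp Fin.revPerm]
      refine Finset.sum_congr rfl fun j _ => ?_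
      simp only [Fin.revPerm_apply, Fin.rev_rev]
      congr 1
      apply h.reflect
      rw [hrev, hrev]
      ring
    rw [h3, h1, h2, hu, Finset.mul_sum]
    simp only [← thetaStar_add_rev hp θ ρ htlt, add_mul, Finset.sum_add_distrib, ← ht, mul_assoc]
    ring
  have e1 := hrec i
  have e2 := hrec i.rev
  rw [Fin.rev_rev] at e2
  have e3 : (1 - t ^ 2) * (B (x 0) (x (i + 1)) - u i) = 0 := by linear_combination e1 - t * e2
  have : t ^ 2 < 1 := (sq_lt_one_iff_abs_lt_one t).mpr htlt
  rcases mul_eq_zero.mp e3 with h' | h'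
  · linarith
  · show u i = _
    linarith

theorem residual_orth (h : IsStationaryAR θ ρ σ B x e v) (hp : 0 < p) (hθ : ∑ i, |θ i| < 1)
    (hρ : |ρ| < 1) (i : ℕ) (hi : i < p) :
    B (x 0 - ∑ j : Fin p, thetaStar hp θ ρ j • x (j + 1)) (x (i + 1)) = 0 := by
  have := h.yule_walker hp hθ hρ ⟨i, hi⟩
  simp only at this
  simp [this]

theorem residual_var_eq (h : IsStationaryAR θ ρ σ B x e v) (hp : 0 < p) (hθ : ∑ i, |θ i| < 1)
    (hρ : |ρ| < 1) :
    B (x 0 - ∑ j : Fin p, thetaStar hp θ ρ j • x (j + 1))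
      (x 0 - ∑ j : Fin p, thetaStar hp θ ρ j • x (j + 1)) =
    B (x 0 - ∑ j : Fin p, thetaStar hp θ ρ j • x (j + 1)) (x 0) := by
  have key : ∀ w, (∀ j : Fin p, B w (x (j + 1)) = 0) →
      B w (x 0 - ∑ j : Fin p, thetaStar hp θ ρ j • x (j + 1)) = B w (x 0) := by
    intro w hw
    simp [hw]
  exact key _ fun j => h.residual_orth hp hθ hρ j j.2

/-- The noise `v 0` is orthogonal to the past, so `B (v 0) z = σ²`, and `B (z - v 0) (z - v 0) ≥ 0`
gives the bound. It keeps the denominator of `ρ̂_n` away from zero in the limit. -/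
theorem le_residual_var (h : IsStationaryAR θ ρ σ B x e v) (hp : 0 < p) (hθ : ∑ i, |θ i| < 1)
    (hρ : |ρ| < 1) :
    σ ^ 2 ≤ B (x 0 - ∑ j : Fin p, thetaStar hp θ ρ j • x (j + 1))
      (x 0 - ∑ j : Fin p, thetaStar hp θ ρ j • x (j + 1)) := by
  set z := x 0 - ∑ j : Fin p, thetaStar hp θ ρ j • x (j + 1) with hz
  have h1 : B (v 0) z = σ ^ 2 := by
    rw [hz, map_sub, map_sum, Finset.sum_eq_zero fun j _ => ?_, sub_zero, h.cov_vx hθ hρ]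
    rw [map_smul, h.orth_vx hθ hρ _ _ (by positivity), smul_zero]
  have h2 := h.nonneg (z - v 0)
  simp only [map_sub, LinearMap.sub_apply, h.symm z (v 0), h1, h.var_v] at h2
  linarith

/-- Pair `rec_ar` with `x (p + 1)` and split `β = θ* + t J θ*`: reflection turns the second part
into `t` times the projection of `x 0` paired with `x 0`. -/
theorem residual_cov_lag (h : IsStationaryAR θ ρ σ B x e v) (hp : 0 < p) (hθ : ∑ i, |θ i| < 1)
    (hρ : |ρ| < 1) :
    B (x 0 - ∑ j : Fin p, thetaStar hp θ ρ j • x (j + 1)) (x (p + 1)) =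
      -(lastCoord hp θ * ρ) * B (x 0 - ∑ j : Fin p, thetaStar hp θ ρ j • x (j + 1)) (x 0) := by
  set t := lastCoord hp θ * ρ with ht
  have htlt : |t| < 1 := abs_lastCoord_mul_lt_one hp θ ρ hθ hρ
  have h1 := h.rec_ar hp (x (p + 1))
  rw [h.orth_vx hθ hρ _ _ (by positivity), add_zero] at h1
  simp only [← thetaStar_add_rev hp θ ρ htlt, add_mul, Finset.sum_add_distrib] at h1
  have h2 : ∑ j : Fin p, lastCoord hp θ * ρ * thetaStar hp θ ρ j.rev * B (x (j + 1)) (x (p + 1))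
      = t * ∑ j : Fin p, thetaStar hp θ ρ j * B (x (j + 1)) (x 0) := by
    rw [← Equiv.sum_comp Fin.revPerm, Finset.mul_sum]
    refine Finset.sum_congr rfl fun j _ => ?_
    simp only [Fin.revPerm_apply, Fin.rev_rev]
    rw [h.reflect (j.rev + 1) (p + 1) (j + 1) 0 (by rw [Fin.val_rev]; omega)]
    ring
  have h3 := h.shift_x (p + 1) 0 0
  rw [zero_add] at h3
  simp only [map_sub, LinearMap.sub_apply, map_sum, LinearMap.sum_apply, map_smul,
    LinearMap.smul_apply, smul_eq_mul]
  rw [h2, h3] at h1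
  linear_combination h1

theorem residual_cov_succ (h : IsStationaryAR θ ρ σ B x e v) (hp : 0 < p)
    (hθ : ∑ i, |θ i| < 1) (hρ : |ρ| < 1) :
    B (x 0 - ∑ j : Fin p, thetaStar hp θ ρ j • x (j + 1))
      (x 1 - ∑ j : Fin p, thetaStar hp θ ρ j • x (j + 1 + 1)) =
    rhoStar hp θ ρ * B (x 0 - ∑ j : Fin p, thetaStar hp θ ρ j • x (j + 1))
      (x 0 - ∑ j : Fin p, thetaStar hp θ ρ j • x (j + 1)) := by
  rw [h.residual_var_eq hp hθ hρ]
  have h0 := h.residual_orth hp hθ hρ 0 hp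
  simp only [Nat.cast_zero, zero_add] at h0
  have hl := h.residual_cov_lag hp hθ hρ
  have ho := h.residual_orth hp hθ hρ
  set z := x 0 - ∑ j : Fin p, thetaStar hp θ ρ j • x (j + 1) with hz
  -- Of the lags `1, …, p + 1` in the shifted residual, only lag `p + 1` is not orthogonal to `z`.
  rw [map_sub, h0, map_sum, Finset.sum_eq_single (⟨p - 1, by omega⟩ : Fin p)]
  · rw [show (((⟨p - 1, by omega⟩ : Fin p) : ℕ) : ℤ) + 1 + 1 = p + 1 by simp; omega]
    rw [map_smul, hl, rhoStar, lastCoord, lastCoord, smul_eq_mul]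
    ring
  · intro j _ hj
    have hj' : (j : ℕ) ≠ p - 1 := fun hh => hj (Fin.ext hh)
    have := ho (j + 1) (by omega)
    push_cast at this
    rw [map_smul, this, smul_zero]
  · simp

theorem residual_var_shift (h : IsStationaryAR θ ρ σ B x e v) (a : Fin p → ℝ) :
    B (x 1 - ∑ j : Fin p, a j • x (j + 1 + 1)) (x 1 - ∑ j : Fin p, a j • x (j + 1 + 1)) =
      B (x 0 - ∑ j : Fin p, a j • x (j + 1)) (x 0 - ∑ j : Fin p, a j • x (j + 1)) := by
  have h0 : ∀ j, B (x 1) (x (j + 1)) = B (x 0) (x j) := fun j => h.shift_x 1 0 j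
  have h1 : ∀ j, B (x (j + 1)) (x 1) = B (x j) (x 0) := fun j => h.shift_x 1 j 0
  have h2 : B (x 1) (x 1) = B (x 0) (x 0) := h.shift_x 1 0 0
  simp only [map_sub, LinearMap.sub_apply, map_sum, LinearMap.sum_apply, map_smul,
    LinearMap.smul_apply, h0, h1, h2, h.shift_x 1]

end IsStationaryAR

/-! ### Time averages and limiting covariances along an ultrafilter -/

/-- Average of `f` over the times `1, …, n`. -/
noncomputable def timeAvg (f : ℤ → ℝ) (n : ℕ) : ℝ := (∑ k ∈ Finset.range n, f ((k : ℤ) + 1)) / n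

theorem timeAvg_add (f g : ℤ → ℝ) (n : ℕ) :
    timeAvg (fun k => f k + g k) n = timeAvg f n + timeAvg g n := by
  simp [timeAvg, Finset.sum_add_distrib, add_div]

theorem timeAvg_mul_left (c : ℝ) (f : ℤ → ℝ) (n : ℕ) :
    timeAvg (fun k => c * f k) n = c * timeAvg f n := by
  simp [timeAvg, ← Finset.mul_sum, mul_div_assoc]

theorem timeAvg_sum {ι : Type*} (s : Finset ι) (f : ι → ℤ → ℝ) (n : ℕ) :
    timeAvg (fun k => ∑ i ∈ s, f i k) n = ∑ i ∈ s, timeAvg (f i) n := by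
  simp only [timeAvg, ← Finset.sum_div]
  rw [Finset.sum_comm]

theorem tendsto_timeAvg_of_eventually_zero (f : ℤ → ℝ) (N : ℕ) (hf : ∀ k : ℤ, N < k → f k = 0) :
    Tendsto (timeAvg f) atTop (𝓝 0) := by
  refine (tendsto_const_div_atTop_nhds_zero_nat
    (∑ k ∈ Finset.range N, f ((k : ℤ) + 1))).congr' ?_
  filter_upwards [eventually_ge_atTop N] with n hn
  rw [timeAvg]
  congr 1
  refine Finset.sum_subset (Finset.range_subset_range.mpr hn) fun k _ hk => hf _ ?_
  simp only [Finset.mem_range, not_lt] at hk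
  omega

/-- Sequences with bounded quadratic averages whose squares are `o(n)`. -/
def quadMean : Submodule ℝ (ℤ → ℝ) where
  carrier := {s | (∃ C : ℝ, ∀ n : ℕ, ∑ k ∈ Finset.range n, s ((k : ℤ) + 1) ^ 2 ≤ C * (n + 1)) ∧
    Tendsto (fun n : ℕ => s n ^ 2 / n) atTop (𝓝 0)}
  zero_mem' := ⟨⟨0, by simp⟩, by simp⟩
  add_mem' := by
    rintro s t ⟨⟨C, hC⟩, hs⟩ ⟨⟨D, hD⟩, ht⟩
    have hsq : ∀ a b : ℝ, (a + b) ^ 2 ≤ 2 * a ^ 2 + 2 * b ^ 2 := fun a b => by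
      nlinarith [sq_nonneg (a - b)]
    refine ⟨⟨2 * C + 2 * D, fun n => ?_⟩, ?_⟩
    · calc ∑ k ∈ Finset.range n, (s + t) ((k : ℤ) + 1) ^ 2
          ≤ ∑ k ∈ Finset.range n, (2 * s ((k : ℤ) + 1) ^ 2 + 2 * t ((k : ℤ) + 1) ^ 2) :=
            Finset.sum_le_sum fun k _ => hsq _ _
        _ = 2 * ∑ k ∈ Finset.range n, s ((k : ℤ) + 1) ^ 2
            + 2 * ∑ k ∈ Finset.range n, t ((k : ℤ) + 1) ^ 2 := by
            rw [Finset.sum_add_distrib, Finset.mul_sum, Finset.mul_sum]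
        _ ≤ _ := by linarith [hC n, hD n]
    · have := (hs.const_mul 2).add (ht.const_mul 2)
      simp only [mul_zero, add_zero] at this
      refine squeeze_zero (fun n => by positivity) (fun n => ?_) this
      rw [← mul_div_assoc, ← mul_div_assoc, ← add_div]
      exact div_le_div_of_nonneg_right (hsq _ _) (by positivity)
  smul_mem' := by
    rintro c s ⟨⟨C, hC⟩, hs⟩
    refine ⟨⟨c ^ 2 * C, fun n => ?_⟩, ?_⟩
    · simp only [Pi.smul_apply, smul_eq_mul, mul_pow, ← Finset.mul_sum]
      rw [mul_assoc]
      exact mul_le_mul_of_nonneg_left (hC n) (sq_nonneg c)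
    · simpa [mul_pow, mul_div_assoc] using hs.const_mul (c ^ 2)

theorem sum_range_le_shift (f : ℤ → ℝ) (hf : ∀ k, 0 ≤ f k) (n : ℕ) :
    ∑ k ∈ Finset.range n, f k ≤ f 0 + ∑ k ∈ Finset.range n, f ((k : ℤ) + 1) := by
  have h1 := Finset.sum_range_succ (fun k : ℕ => f k) n
  have h2 := Finset.sum_range_succ' (fun k : ℕ => f k) n
  push_cast at h2
  have := hf n
  linarith

theorem quadMean_lag_one {s : ℤ → ℝ} (hs : s ∈ quadMean) : (fun k => s (k - 1)) ∈ quadMean := by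
  obtain ⟨⟨C, hC⟩, hs⟩ := hs
  refine ⟨⟨s 0 ^ 2 + C, fun n => ?_⟩, ?_⟩
  · have h1 := sum_range_le_shift (fun k => s k ^ 2) (fun k => sq_nonneg _) n
    have h2 := hC n
    simp only [add_sub_cancel_right]
    have : 0 ≤ s 0 ^ 2 * n := by positivity
    linarith
  · rw [← tendsto_add_atTop_iff_nat 1]
    refine squeeze_zero' (Eventually.of_forall fun n => by positivity) ?_ hs
    filter_upwards [eventually_gt_atTop 0] with n hn
    push_cast
    rw [add_sub_cancel_right]
    have : (0 : ℝ) < n := by exact_mod_cast hn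
    gcongr
    linarith

theorem quadMean_lag_neg_one {s : ℤ → ℝ} (hs : s ∈ quadMean) :
    (fun k => s (k + 1)) ∈ quadMean := by
  obtain ⟨⟨C, hC⟩, hs⟩ := hs
  have hC0 : 0 ≤ C := by simpa using hC 0
  refine ⟨⟨2 * C, fun n => ?_⟩, ?_⟩
  · have h1 := hC (n + 1)
    rw [Finset.sum_range_succ'] at h1
    push_cast at h1
    have : 0 ≤ C * n := by positivity
    have : 0 ≤ s 1 ^ 2 := sq_nonneg _
    simp only
    linarith
  · have h1 := ((tendsto_add_atTop_iff_nat 1).mpr hs).const_mul 2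
    rw [mul_zero] at h1
    refine squeeze_zero' (Eventually.of_forall fun n => by positivity) ?_ h1
    filter_upwards [eventually_gt_atTop 0] with n hn
    push_cast
    have : (1 : ℝ) ≤ n := by exact_mod_cast hn
    rw [← mul_div_assoc, div_le_div_iff₀ (by positivity) (by positivity)]
    nlinarith [sq_nonneg (s (n + 1))]

theorem quadMean_lag {s : ℤ → ℝ} (hs : s ∈ quadMean) (j : ℤ) :
    (fun k => s (k - j)) ∈ quadMean := by
  induction j using Int.induction_on with
  | zero => simpa using hs
  | succ i ih => simpa [sub_sub, add_comm] using quadMean_lag_one ih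
  | pred i ih =>
    have := quadMean_lag_neg_one ih
    convert this using 3
    ring

/-- The `j`-th lag of a sequence. -/
def lagSeq (j : ℤ) (s : quadMean) : quadMean := ⟨fun k => s.1 (k - j), quadMean_lag s.2 j⟩

theorem lagSeq_add (i j : ℤ) (s : quadMean) : lagSeq (i + j) s = lagSeq j (lagSeq i s) := by
  ext k
  exact congrArg s.1 (by ring : k - (i + j) = k - j - i)

/-- The averages stay in a compact interval by `2|ab| ≤ a² + b²`, and an ultrafilter on a compact
set converges. -/
theorem exists_tendsto_timeAvg_mul (𝒰 : Ultrafilter ℕ) (s t : quadMean) :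
    ∃ c, Tendsto (timeAvg fun k => s.1 k * t.1 k) 𝒰 (𝓝 c) := by
  obtain ⟨s, ⟨C, hC⟩, -⟩ := s
  obtain ⟨t, ⟨D, hD⟩, -⟩ := t
  have hC0 : 0 ≤ C := by simpa using hC 0
  have hD0 : 0 ≤ D := by simpa using hD 0
  have hb : ∀ n, timeAvg (fun k => s k * t k) n ∈ Set.Icc (-(C + D)) (C + D) := by
    intro n
    rcases Nat.eq_zero_or_pos n with rfl | hn
    · simp [timeAvg]; constructor <;> linarith
    have hn' : (1 : ℝ) ≤ n := by exact_mod_cast hn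
    rw [Set.mem_Icc, ← abs_le, timeAvg, abs_div, Nat.abs_cast, div_le_iff₀ (by positivity)]
    calc |∑ k ∈ Finset.range n, s ((k : ℤ) + 1) * t ((k : ℤ) + 1)|
        ≤ ∑ k ∈ Finset.range n, |s ((k : ℤ) + 1) * t ((k : ℤ) + 1)| :=
          Finset.abs_sum_le_sum_abs _ _
      _ ≤ ∑ k ∈ Finset.range n, (s ((k : ℤ) + 1) ^ 2 / 2 + t ((k : ℤ) + 1) ^ 2 / 2) := by
          refine Finset.sum_le_sum fun k _ => abs_le.mpr ⟨?_, ?_⟩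
          · nlinarith [sq_nonneg (s ((k : ℤ) + 1) + t ((k : ℤ) + 1))]
          · nlinarith [sq_nonneg (s ((k : ℤ) + 1) - t ((k : ℤ) + 1))]
      _ ≤ C * (n + 1) / 2 + D * (n + 1) / 2 := by
          rw [Finset.sum_add_distrib, ← Finset.sum_div, ← Finset.sum_div]
          linarith [hC n, hD n]
      _ ≤ (C + D) * n := by nlinarith
  obtain ⟨c, -, hc⟩ := (isCompact_Icc (a := -(C + D)) (b := C + D)).ultrafilter_le_nhds
    (𝒰.map (timeAvg fun k => s k * t k))
    (by rw [le_principal_iff]; exact Filter.mem_map.mpr (Filter.univ_mem' hb))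
  exact ⟨c, hc⟩

/-- Limit of the empirical covariance along an ultrafilter. -/
noncomputable def limCov (𝒰 : Ultrafilter ℕ) : quadMean →ₗ[ℝ] quadMean →ₗ[ℝ] ℝ :=
  LinearMap.mk₂ ℝ (fun s t => limUnder (𝒰 : Filter ℕ) (timeAvg fun k => s.1 k * t.1 k))
    (fun s s' t => by
      refine Tendsto.limUnder_eq ?_
      convert (tendsto_nhds_limUnder (exists_tendsto_timeAvg_mul 𝒰 s t)).add
        (tendsto_nhds_limUnder (exists_tendsto_timeAvg_mul 𝒰 s' t)) using 2 with n
      rw [← timeAvg_add]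
      simp [add_mul])
    (fun c s t => by
      refine Tendsto.limUnder_eq ?_
      convert (tendsto_nhds_limUnder (exists_tendsto_timeAvg_mul 𝒰 s t)).const_mul c using 2 with n
      · rw [← timeAvg_mul_left]
        simp [mul_assoc]
      · simp)
    (fun s t t' => by
      refine Tendsto.limUnder_eq ?_
      convert (tendsto_nhds_limUnder (exists_tendsto_timeAvg_mul 𝒰 s t)).add
        (tendsto_nhds_limUnder (exists_tendsto_timeAvg_mul 𝒰 s t')) using 2 with n
      rw [← timeAvg_add]
      simp [mul_add])
    (fun c s t => by
      refine Tendsto.limUnder_eq ?_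
      convert (tendsto_nhds_limUnder (exists_tendsto_timeAvg_mul 𝒰 s t)).const_mul c using 2 with n
      · rw [← timeAvg_mul_left]
        simp [mul_left_comm]
      · simp)

theorem tendsto_limCov (𝒰 : Ultrafilter ℕ) (s t : quadMean) :
    Tendsto (timeAvg fun k => s.1 k * t.1 k) 𝒰 (𝓝 (limCov 𝒰 s t)) :=
  tendsto_nhds_limUnder (exists_tendsto_timeAvg_mul 𝒰 s t)

theorem limCov_comm (𝒰 : Ultrafilter ℕ) (s t : quadMean) : limCov 𝒰 s t = limCov 𝒰 t s := by
  refine tendsto_nhds_unique (tendsto_limCov 𝒰 s t) ?_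
  simpa only [mul_comm] using tendsto_limCov 𝒰 t s

theorem limCov_self_nonneg (𝒰 : Ultrafilter ℕ) (s : quadMean) : 0 ≤ limCov 𝒰 s s := by
  refine ge_of_tendsto' (tendsto_limCov 𝒰 s s) fun n => ?_
  exact div_nonneg (Finset.sum_nonneg fun k _ => mul_self_nonneg _) (by positivity)

theorem limCov_congr (𝒰 : Ultrafilter ℕ) (h𝒰 : (𝒰 : Filter ℕ) ≤ atTop) (s s' t : quadMean) (N : ℕ)
    (h : ∀ k : ℤ, N < k → s.1 k = s'.1 k) : limCov 𝒰 s t = limCov 𝒰 s' t := by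
  rw [← sub_eq_zero, ← LinearMap.sub_apply, ← map_sub]
  refine tendsto_nhds_unique (tendsto_limCov 𝒰 (s - s') t)
    ((tendsto_timeAvg_of_eventually_zero _ N fun k hk => ?_).mono_left h𝒰)
  simp [h k hk]

/-- Shifting changes the average only by the boundary term `(s_0 t_0 - s_n t_n) / n`; this is why
`quadMean` requires squares to be `o(n)`. -/
theorem limCov_lag_one (𝒰 : Ultrafilter ℕ) (h𝒰 : (𝒰 : Filter ℕ) ≤ atTop) (s t : quadMean) :
    limCov 𝒰 (lagSeq 1 s) (lagSeq 1 t) = limCov 𝒰 s t := by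
  have hdiff : Tendsto (fun n : ℕ => (s.1 0 * t.1 0 - s.1 n * t.1 n) / n) atTop (𝓝 0) := by
    have h1 := tendsto_const_div_atTop_nhds_zero_nat (s.1 0 * t.1 0)
    have h2 : Tendsto (fun n : ℕ => s.1 n * t.1 n / n) atTop (𝓝 0) := by
      have h3 := s.2.2.add t.2.2
      rw [add_zero] at h3
      refine squeeze_zero_norm (fun n => ?_) h3
      rw [Real.norm_eq_abs, abs_div, Nat.abs_cast, ← add_div]
      refine div_le_div_of_nonneg_right (abs_le.mpr ⟨?_, ?_⟩) (by positivity)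
      · nlinarith [sq_nonneg (s.1 n + t.1 n), sq_nonneg (s.1 n), sq_nonneg (t.1 n)]
      · nlinarith [sq_nonneg (s.1 n - t.1 n), sq_nonneg (s.1 n), sq_nonneg (t.1 n)]
    simpa [sub_div] using h1.sub h2
  refine tendsto_nhds_unique (tendsto_limCov 𝒰 _ _) ?_
  have := (tendsto_limCov 𝒰 s t).add (hdiff.mono_left h𝒰)
  rw [add_zero] at this
  refine this.congr fun n => ?_
  have h1 := Finset.sum_range_succ (fun k : ℕ => s.1 k * t.1 k) n
  have h2 := Finset.sum_range_succ' (fun k : ℕ => s.1 k * t.1 k) n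
  push_cast at h2
  simp only [timeAvg, lagSeq, add_sub_cancel_right, ← add_div]
  congr 1
  linarith

theorem limCov_lag (𝒰 : Ultrafilter ℕ) (h𝒰 : (𝒰 : Filter ℕ) ≤ atTop) (j : ℤ) (s t : quadMean) :
    limCov 𝒰 (lagSeq j s) (lagSeq j t) = limCov 𝒰 s t := by
  induction j using Int.induction_on with
  | zero => simp [lagSeq]
  | succ i ih => rw [lagSeq_add, lagSeq_add, limCov_lag_one 𝒰 h𝒰, ih]
  | pred i ih =>
    rw [← limCov_lag_one 𝒰 h𝒰, ← lagSeq_add, ← lagSeq_add, sub_add_cancel, ih]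

/-! ### Stability of contractive recursions -/

theorem sum_range_lag_le (y : ℤ → ℝ) (hy : ∀ k, 0 ≤ y k) (i n : ℕ) :
    ∑ k ∈ Finset.range n, y ((k : ℤ) - i) ≤
      ∑ l ∈ Finset.range (i + 1), y (-(l : ℤ)) + ∑ k ∈ Finset.range n, y ((k : ℤ) + 1) := by
  induction i with
  | zero => simpa using sum_range_le_shift y hy n
  | succ i ih =>
    have := sum_range_le_shift (fun k => y (k - (i + 1))) (fun k => hy _) n
    rw [Finset.sum_range_succ]
    simp only [add_sub_add_right_eq_sub, zero_sub] at this
    push_cast at this ⊢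
    linarith

/-- Summing the inequality bounds the partial sum `Q` by `K + (∑ c_i) Q + C (n + 1)`, with `K`
collecting values at nonpositive times; the middle term is absorbed on the left. -/
theorem sum_le_of_contraction {q : ℕ} (c : Fin q → ℝ) (hc0 : ∀ i, 0 ≤ c i) (hc : ∑ i, c i < 1)
    (y w : ℤ → ℝ) (hy : ∀ k, 0 ≤ y k)
    (hyw : ∀ n : ℕ, y (n + 1) ≤ ∑ i, c i * y ((n : ℤ) - i) + w (n + 1))
    (C : ℝ)
    (hw : ∀ n : ℕ, ∑ k ∈ Finset.range n, w ((k : ℤ) + 1) ≤ C * (n + 1)) :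
    ∃ D : ℝ, ∀ n : ℕ, ∑ k ∈ Finset.range n, y ((k : ℤ) + 1) ≤ D * (n + 1) := by
  set K := ∑ i : Fin q, c i * ∑ l ∈ Finset.range ((i : ℕ) + 1), y (-(l : ℤ)) with hK
  have hK0 : 0 ≤ K := Finset.sum_nonneg fun i _ =>
    mul_nonneg (hc0 i) (Finset.sum_nonneg fun l _ => hy _)
  refine ⟨(K + C) / (1 - ∑ i, c i), fun n => ?_⟩
  set Q := ∑ k ∈ Finset.range n, y ((k : ℤ) + 1) with hQ
  have h1 : Q ≤ K + (∑ i, c i) * Q + C * (n + 1) := by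
    calc Q ≤ ∑ k ∈ Finset.range n, (∑ i, c i * y ((k : ℤ) - i) + w ((k : ℤ) + 1)) :=
          Finset.sum_le_sum fun k _ => hyw k
      _ = ∑ i, c i * ∑ k ∈ Finset.range n, y ((k : ℤ) - i)
          + ∑ k ∈ Finset.range n, w ((k : ℤ) + 1) := by
          rw [Finset.sum_add_distrib, Finset.sum_comm]
          simp only [Finset.mul_sum]
      _ ≤ ∑ i : Fin q, c i * (∑ l ∈ Finset.range ((i : ℕ) + 1), y (-(l : ℤ)) + Q)
          + C * (n + 1) := by
          refine add_le_add (Finset.sum_le_sum fun i _ => ?_) (hw n)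
          exact mul_le_mul_of_nonneg_left (sum_range_lag_le y hy i n) (hc0 i)
      _ = K + (∑ i, c i) * Q + C * (n + 1) := by
          simp only [mul_add, Finset.sum_add_distrib, Finset.sum_mul, hK]
  rw [div_mul_eq_mul_div, le_div_iff₀ (by linarith)]
  have : 0 ≤ K * n := by positivity
  linarith

theorem tendsto_div_of_contraction {q : ℕ} (c : Fin q → ℝ) (hc0 : ∀ i, 0 ≤ c i) (hc : ∑ i, c i < 1)
    (y w : ℤ → ℝ) (hy : ∀ k, 0 ≤ y k)
    (hyw : ∀ n : ℕ, y (n + 1) ≤ ∑ i, c i * y ((n : ℤ) - i) + w (n + 1))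
    (hw : Tendsto (fun n : ℕ => w n / n) atTop (𝓝 0)) :
    Tendsto (fun n : ℕ => y n / n) atTop (𝓝 0) := by
  have hbound : ∀ δ : ℝ, 0 < δ → ∃ D : ℝ, ∀ n : ℕ, y n ≤ D + δ * n := by
    intro δ hδ
    set a := ∑ i, c i with ha
    have hδa : 0 < δ * (1 - a) := mul_pos hδ (by linarith)
    obtain ⟨N, hN⟩ := eventually_atTop.mp (hw.eventually_lt_const hδa)
    set C := ∑ k ∈ Finset.range (N + 1), |w k| with hCdef
    have hC0 : 0 ≤ C := Finset.sum_nonneg fun k _ => abs_nonneg _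
    have hwC : ∀ n : ℕ, w n ≤ C + δ * (1 - a) * n := by
      intro n
      rcases le_or_gt n N with hn | hn
      · have h1 : |w n| ≤ C := Finset.single_le_sum (f := fun k : ℕ => |w k|)
          (fun k _ => abs_nonneg _) (Finset.mem_range.mpr (by omega))
        have h2 : 0 ≤ δ * (1 - a) * n := by positivity
        linarith [le_abs_self (w n)]
      · have hn0 : (0 : ℝ) < n := by exact_mod_cast (by omega : 0 < n)
        have := (div_lt_iff₀ hn0).mp (hN n hn.le)
        linarith
    -- `D` dominates the initial values and satisfies `C ≤ D (1 - a)`, which closes the induction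
    -- for `y n ≤ D + δ n`.
    set D := C / (1 - a) + ∑ l ∈ Finset.range (q + 1), y (-(l : ℤ)) with hD
    have hCa : 0 ≤ C / (1 - a) := div_nonneg hC0 (by linarith)
    have hD1 : ∀ l : ℕ, l ≤ q → y (-(l : ℤ)) ≤ D := by
      intro l hl
      have := Finset.single_le_sum (f := fun l : ℕ => y (-(l : ℤ)))
        (fun k _ => hy _) (Finset.mem_range.mpr (by omega : l < q + 1))
      linarith
    have hD2 : C ≤ D * (1 - a) := by
      rw [← div_le_iff₀ (by linarith), hD]
      linarith [Finset.sum_nonneg fun (l : ℕ) (_ : l ∈ Finset.range (q + 1)) => hy (-(l : ℤ))]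
    refine ⟨D, fun n => ?_⟩
    induction n using Nat.strong_induction_on with
    | _ n ih =>
      rcases n with _ | n
      · simpa using hD1 0 (Nat.zero_le _)
      · have h1 : ∑ i, c i * y ((n : ℤ) - i) ≤ a * (D + δ * (n + 1)) := by
          rw [ha, Finset.sum_mul]
          refine Finset.sum_le_sum fun i _ => mul_le_mul_of_nonneg_left ?_ (hc0 i)
          rcases le_or_gt (i : ℕ) n with hi | hi
          · have := ih (n - i) (by omega)
            rw [Nat.cast_sub hi, Nat.cast_sub hi] at this
            have : δ * ((n : ℝ) - (i : ℕ)) ≤ δ * (n + 1) := by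
              have : (0 : ℝ) ≤ (i : ℕ) := Nat.cast_nonneg _
              gcongr
              linarith
            linarith
          · have := hD1 (i - n) (by omega)
            rw [show -(((i : ℕ) - n : ℕ) : ℤ) = (n : ℤ) - i by omega] at this
            have : 0 ≤ δ * ((n : ℝ) + 1) := by positivity
            linarith
        have h2 := hyw n
        have h3 := hwC (n + 1)
        push_cast at h3 ⊢
        linarith
  refine tendsto_order.mpr ⟨fun b hb => Eventually.of_forall fun n =>
    hb.trans_le (div_nonneg (hy _) (by positivity)), fun b hb => ?_⟩
  obtain ⟨D, hD⟩ := hbound (b / 2) (by linarith)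
  filter_upwards [(tendsto_const_div_atTop_nhds_zero_nat D).eventually_lt_const
    (by linarith : (0 : ℝ) < b / 2), eventually_gt_atTop 0] with n hn hn0
  have hn' : (0 : ℝ) < n := by exact_mod_cast hn0
  rw [div_lt_iff₀ hn'] at hn ⊢
  linarith [hD n]

/-- This is Jensen's inequality for the square, with weights `|a_i|` on `± s_i` and `1 - ∑ |a_i|` on
`u / (1 - ∑ |a_i|)`. -/
theorem sq_add_le_of_contraction {q : ℕ} (a s : Fin q → ℝ) (ha : ∑ i, |a i| < 1) (u : ℝ) :
    (∑ i, a i * s i + u) ^ 2 ≤ ∑ i, |a i| * s i ^ 2 + u ^ 2 / (1 - ∑ i, |a i|) := by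
  set A := ∑ i, |a i| with hA
  set P := ∑ i, a i * s i with hP
  set Y := ∑ i, |a i| * s i ^ 2 with hY
  have hCS : P ^ 2 ≤ A * Y := by
    refine Finset.sum_sq_le_sum_mul_sum_of_sq_le_mul _ (fun i _ => abs_nonneg _)
      (fun i _ => by positivity) fun i _ => ?_
    rw [mul_pow, ← sq_abs (a i)]
    exact le_of_eq (by ring)
  have hA0 : 0 ≤ A := Finset.sum_nonneg fun i _ => abs_nonneg _
  have hY0 : 0 ≤ Y := Finset.sum_nonneg fun i _ => by positivity
  have hA1 : 0 < 1 - A := by linarith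
  obtain ⟨w, rfl⟩ : ∃ w, u = (1 - A) * w := ⟨u / (1 - A), by field_simp⟩
  have : ((1 - A) * w) ^ 2 / (1 - A) = (1 - A) * w ^ 2 := by field_simp
  rw [this]
  rcases hA0.eq_or_lt with h0 | h0
  · rw [← h0] at hCS ⊢
    have : P = 0 := by
      have : P ^ 2 = 0 := le_antisymm (by linarith) (sq_nonneg _)
      exact pow_eq_zero_iff two_ne_zero |>.mp this
    rw [this]
    nlinarith
  · have key : 0 ≤ A * (Y + (1 - A) * w ^ 2 - (P + (1 - A) * w) ^ 2) := by
      have := mul_nonneg hA1.le (sq_nonneg (P - A * w))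
      nlinarith
    have := nonneg_of_mul_nonneg_right key h0
    linarith

theorem quadMean_of_recursion {q : ℕ} (a : Fin q → ℝ) (ha : ∑ i, |a i| < 1) (s u : ℤ → ℝ)
    (hu : u ∈ quadMean) (hs : ∀ n : ℕ, s (n + 1) = ∑ i, a i * s ((n : ℤ) - i) + u (n + 1)) :
    s ∈ quadMean := by
  obtain ⟨⟨C, hC⟩, hu⟩ := hu
  have hyw : ∀ n : ℕ, s (n + 1) ^ 2 ≤
      ∑ i, |a i| * s ((n : ℤ) - i) ^ 2 + u (n + 1) ^ 2 / (1 - ∑ i, |a i|) := fun n => by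
    rw [hs]
    exact sq_add_le_of_contraction a _ ha _
  refine ⟨?_, ?_⟩
  · refine sum_le_of_contraction (fun i => |a i|) (fun i => abs_nonneg _) ha (fun k => s k ^ 2)
      (fun k => u k ^ 2 / (1 - ∑ i, |a i|)) (fun k => sq_nonneg _) hyw (C / (1 - ∑ i, |a i|))
      fun n => ?_
    rw [← Finset.sum_div, div_mul_eq_mul_div]
    exact div_le_div_of_nonneg_right (hC n) (by linarith)
  · refine tendsto_div_of_contraction (fun i => |a i|) (fun i => abs_nonneg _) ha (fun k => s k ^ 2)
      (fun k => u k ^ 2 / (1 - ∑ i, |a i|)) (fun k => sq_nonneg _) hyw ?_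
    have := hu.div_const (1 - ∑ i, |a i|)
    rw [zero_div] at this
    simpa only [div_right_comm] using this

theorem quadMean_of_tendsto_timeAvg_sq {s : ℤ → ℝ} {c : ℝ}
    (h : Tendsto (timeAvg fun k => s k ^ 2) atTop (𝓝 c)) : s ∈ quadMean := by
  constructor
  · obtain ⟨C, hC⟩ := h.bddAbove_range
    have hC' : ∀ n, timeAvg (fun k => s k ^ 2) n ≤ C := fun n => hC ⟨n, rfl⟩
    have hC0 : 0 ≤ C := by simpa [timeAvg] using hC' 0
    refine ⟨C, fun n => ?_⟩
    rcases Nat.eq_zero_or_pos n with rfl | hn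
    · simpa using hC0
    have hn' : (0 : ℝ) < n := by exact_mod_cast hn
    have := (div_le_iff₀ hn').mp (hC' n)
    linarith
  · rw [← tendsto_add_atTop_iff_nat 1]
    have h1 := (tendsto_add_atTop_iff_nat 1).mpr h
    have h2 := h.mul (tendsto_natCast_div_add_atTop (1 : ℝ))
    have h3 := h1.sub h2
    rw [mul_one, sub_self] at h3
    -- The last term over `n + 1` is the average at `n + 1` minus `n / (n + 1)` times the average at
    -- `n`.
    refine h3.congr' ?_
    filter_upwards [eventually_gt_atTop 0] with n hn
    have hn' : (n : ℝ) ≠ 0 := by exact_mod_cast hn.ne'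
    simp only [timeAvg, Finset.sum_range_succ]
    push_cast
    field_simp
    ring

/-! ### Strong laws for squares and lagged products -/

/-- For `r < d`, the quotient `(n + (d - 1 - r)) / d` counts the `k < n` congruent to `r` modulo
`d`. -/
theorem sum_range_eq_sum_residues (a : ℕ → ℝ) (d : ℕ) (hd : 0 < d) (n : ℕ) :
    ∑ k ∈ Finset.range n, a k =
      ∑ r ∈ Finset.range d, ∑ m ∈ Finset.range ((n + (d - 1 - r)) / d), a (d * m + r) := by
  induction n with
  | zero =>
    rw [Finset.range_zero, Finset.sum_empty]
    refine (Finset.sum_eq_zero fun r _ => ?_).symm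
    rw [Nat.div_eq_of_lt (by omega), Finset.range_zero, Finset.sum_empty]
  | succ n ih =>
    have hstep : ∀ r ∈ Finset.range d,
        ∑ m ∈ Finset.range ((n + 1 + (d - 1 - r)) / d), a (d * m + r) =
          ∑ m ∈ Finset.range ((n + (d - 1 - r)) / d), a (d * m + r)
            + if n % d = r then a n else 0 := by
      intro r hr
      rw [Finset.mem_range] at hr
      have hn := Nat.div_add_mod n d
      have hlt := Nat.mod_lt n hd
      rw [add_right_comm, Nat.succ_div]
      by_cases h : n % d = r
      · have hq : (n + (d - 1 - r)) / d = n / d := by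
          rw [show n + (d - 1 - r) = (d - 1) + d * (n / d) by omega,
            Nat.add_mul_div_left _ _ hd, Nat.div_eq_of_lt (by omega), zero_add]
        have hdvd : d ∣ n + (d - 1 - r) + 1 :=
          ⟨n / d + 1, by rw [mul_add, mul_one]; omega⟩
        rw [if_pos hdvd, if_pos h, hq, Finset.sum_range_succ]
        congr 2
        omega
      · rw [if_neg h, if_neg, add_zero, add_zero]
        intro hdvd
        apply h
        have h1 : n + (d - 1 - r) + 1 + r = n + d := by omega
        have h2 : (n + d) % d = r % d := by
          rw [← h1, Nat.add_mod, Nat.mod_eq_zero_of_dvd hdvd, zero_add, Nat.mod_mod]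
        rwa [Nat.add_mod_right, Nat.mod_eq_of_lt hr] at h2
    rw [Finset.sum_range_succ, Finset.sum_congr rfl hstep, Finset.sum_add_distrib, ← ih,
      Finset.sum_ite_eq, if_pos (Finset.mem_range.mpr (Nat.mod_lt n hd))]

theorem tendsto_average_of_residues (a : ℕ → ℝ) (d : ℕ) (hd : 0 < d)
    (h : ∀ r, Tendsto (fun N : ℕ => (∑ m ∈ Finset.range N, a (d * m + r)) / N) atTop (𝓝 0)) :
    Tendsto (fun n : ℕ => (∑ k ∈ Finset.range n, a k) / n) atTop (𝓝 0) := by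
  have heq : (fun n : ℕ => (∑ k ∈ Finset.range n, a k) / n) = fun n : ℕ => ∑ r ∈ Finset.range d,
      (∑ m ∈ Finset.range ((n + (d - 1 - r)) / d), a (d * m + r)) / n := by
    funext n
    rw [sum_range_eq_sum_residues a d hd, Finset.sum_div]
  rw [heq, ← Finset.sum_const_zero (s := Finset.range d)]
  refine tendsto_finsetSum _ fun r _ => ?_
  have hc : Tendsto (fun n : ℕ => (n + (d - 1 - r)) / d) atTop atTop :=
    (Nat.tendsto_div_const_atTop hd.ne').comp (tendsto_add_atTop_nat _)
  refine squeeze_zero_norm' ?_ (by simpa using ((h r).comp hc).norm)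
  filter_upwards [eventually_gt_atTop 0] with n hn
  simp only [norm_div, RCLike.norm_natCast]
  rcases Nat.eq_zero_or_pos ((n + (d - 1 - r)) / d) with h0 | h0
  · simp [h0]
  · have hle : (n + (d - 1 - r)) / d ≤ n := by
      refine Nat.div_le_of_le_mul ?_
      have : n * 1 + d * 1 ≤ d * n + 1 := by nlinarith
      omega
    have h0' : (0 : ℝ) < (((n + (d - 1 - r)) / d : ℕ) : ℝ) := by exact_mod_cast h0
    have hle' : (((n + (d - 1 - r)) / d : ℕ) : ℝ) ≤ n := by exact_mod_cast hle
    exact div_le_div_of_nonneg_left (norm_nonneg _) h0' hle'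

theorem ae_tendsto_average_sq {Ω : Type*} [MeasurableSpace Ω] {μ : Measure Ω} {σ : ℝ}
    {W : ℕ → Ω → ℝ} (hmeas : ∀ n, Measurable (W n)) (hsq : ∀ n, MemLp (W n) 2 μ)
    (hindep : iIndepFun W μ) (hident : ∀ n, IdentDistrib (W n) (W 0) μ μ)
    (hmean : ∀ n, ∫ ω, W n ω ∂μ = 0) (hvar : ∀ n, variance (W n) μ = σ ^ 2) :
    ∀ᵐ ω ∂μ, Tendsto (fun n : ℕ => (∑ k ∈ Finset.range n, W k ω ^ 2) / n) atTop
      (𝓝 (σ ^ 2)) := by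
  have := strong_law_ae_real (μ := μ) (fun n ω => W n ω ^ 2) (hsq 0).integrable_sq
    (fun i j hij => (hindep.indepFun hij).comp (measurable_id.pow_const 2)
      (measurable_id.pow_const 2))
    (fun n => (hident n).comp (measurable_id.pow_const 2))
  rwa [← variance_of_integral_eq_zero (hmeas 0).aemeasurable (hmean 0), hvar 0] at this

/-- Nearby products may share a factor. Along a progression of step `j + 1` the index pairs `{k, k +
j}` are disjoint, so the strong law applies to each residue class, with mean `0`. -/
theorem ae_tendsto_average_mul_lag {Ω : Type*} [MeasurableSpace Ω] {μ : Measure Ω}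
    [IsProbabilityMeasure μ]
    {W : ℕ → Ω → ℝ} (hmeas : ∀ n, Measurable (W n)) (hsq : ∀ n, MemLp (W n) 2 μ)
    (hindep : iIndepFun W μ) (hident : ∀ n, IdentDistrib (W n) (W 0) μ μ)
    (hmean : ∀ n, ∫ ω, W n ω ∂μ = 0) (j : ℕ) (hj : 0 < j) :
    ∀ᵐ ω ∂μ, Tendsto (fun n : ℕ => (∑ k ∈ Finset.range n, W (k + j) ω * W k ω) / n) atTop
      (𝓝 0) := by
  have hii : ∀ m n, IdentDistrib (W m) (W n) μ μ := fun m n => (hident m).trans (hident n).symm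
  have key : ∀ r : ℕ, ∀ᵐ ω ∂μ, Tendsto (fun N : ℕ => (∑ m ∈ Finset.range N,
      W ((j + 1) * m + r + j) ω * W ((j + 1) * m + r) ω) / N) atTop (𝓝 0) := by
    intro r
    have hind : ∀ k, IndepFun (W (k + j)) (W k) μ := fun k => hindep.indepFun (by omega)
    have := strong_law_ae_real (μ := μ)
      (fun m ω => W ((j + 1) * m + r + j) ω * W ((j + 1) * m + r) ω)
      ((hsq _).integrable_mul (hsq _))
      (fun m n hmn => by
        have hne : (j + 1) * m ≠ (j + 1) * n := fun h => hmn (Nat.eq_of_mul_eq_mul_left (by omega) h)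
        have hne1 : (j + 1) * m + j ≠ (j + 1) * n := fun h => by
          have h1 := congrArg (· % (j + 1)) h
          simp only [Nat.mul_add_mod, Nat.mul_mod_right, Nat.mod_eq_of_lt (Nat.lt_succ_self j)] at h1
          omega
        have hne2 : (j + 1) * n + j ≠ (j + 1) * m := fun h => by
          have h1 := congrArg (· % (j + 1)) h
          simp only [Nat.mul_add_mod, Nat.mul_mod_right, Nat.mod_eq_of_lt (Nat.lt_succ_self j)] at h1
          omega
        exact hindep.indepFun_mul_mul hmeas _ _ _ _ (by omega) (by omega) (by omega) (by omega))
      (fun m => ((hii _ _).prodMk (hii _ _) (hind _) (hind _)).comp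
        (measurable_fst.mul measurable_snd))
    have h0 : ∫ ω, W ((j + 1) * 0 + r + j) ω * W ((j + 1) * 0 + r) ω ∂μ = 0 := by
      rw [(hind _).integral_fun_mul_eq_mul_integral (hmeas _).aestronglyMeasurable
        (hmeas _).aestronglyMeasurable, hmean, zero_mul]
    rwa [h0] at this
  filter_upwards [ae_all_iff.mpr key] with ω hω
  exact tendsto_average_of_residues (fun k => W (k + j) ω * W k ω) (j + 1) (by omega) hω

/-! ### Convergence of the estimators -/

/-- The coefficients vary with the stage `n` but not with the time `k`, so they come out of each
average once the product is expanded. -/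
theorem tendsto_timeAvg_residual_mul (𝒰 : Ultrafilter ℕ) {p : ℕ} (a : ℕ → Fin p → ℝ)
    (b : Fin p → ℝ) (hab : Tendsto a 𝒰 (𝓝 b)) (f f' : quadMean) (g g' : Fin p → quadMean) :
    Tendsto (fun n => timeAvg (fun k => (f.1 k - ∑ i, a n i * (g i).1 k) *
      (f'.1 k - ∑ i, a n i * (g' i).1 k)) n) 𝒰
      (𝓝 (limCov 𝒰 (f - ∑ i, b i • g i) (f' - ∑ i, b i • g' i))) := by
  have ha : ∀ i, Tendsto (fun n => a n i) 𝒰 (𝓝 (b i)) := fun i => (tendsto_pi_nhds.mp hab) i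
  have h := (((tendsto_limCov 𝒰 f f').sub
    (tendsto_finsetSum Finset.univ fun i _ => (ha i).mul (tendsto_limCov 𝒰 f (g' i)))).sub
    (tendsto_finsetSum Finset.univ fun i _ => (ha i).mul (tendsto_limCov 𝒰 (g i) f'))).add
    (tendsto_finsetSum Finset.univ fun i _ => (ha i).mul
      (tendsto_finsetSum Finset.univ fun j _ => (ha j).mul (tendsto_limCov 𝒰 (g i) (g' j))))
  have hexp : ∀ n k, (f.1 k - ∑ i, a n i * (g i).1 k) * (f'.1 k - ∑ i, a n i * (g' i).1 k) =
      f.1 k * f'.1 k + (-1) * (∑ i, a n i * (f.1 k * (g' i).1 k)) +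
        (-1) * (∑ i, a n i * ((g i).1 k * f'.1 k)) +
        ∑ i, a n i * ∑ j, a n j * ((g i).1 k * (g' j).1 k) := by
    intro n k
    have s1 : ∑ i, a n i * (f.1 k * (g' i).1 k) = f.1 k * ∑ i, a n i * (g' i).1 k := by
      simp only [Finset.mul_sum, mul_left_comm]
    have s2 : ∑ i, a n i * ((g i).1 k * f'.1 k) = (∑ i, a n i * (g i).1 k) * f'.1 k := by
      simp only [Finset.sum_mul, mul_assoc]
    have s3 : ∑ i, a n i * ∑ j, a n j * ((g i).1 k * (g' j).1 k) =
        (∑ i, a n i * (g i).1 k) * ∑ i, a n i * (g' i).1 k := by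
      rw [Finset.sum_mul_sum]
      refine Finset.sum_congr rfl fun i _ => ?_
      rw [Finset.mul_sum]
      exact Finset.sum_congr rfl fun j _ => by ring
    rw [s1, s2, s3]
    ring
  convert h using 2 with n
  · simp only [hexp, timeAvg_add, timeAvg_mul_left, timeAvg_sum]
    ring
  · simp only [map_sub, LinearMap.sub_apply, map_sum, LinearMap.sum_apply, map_smul,
      LinearMap.smul_apply, smul_eq_mul, mul_sub, Finset.sum_sub_distrib, Finset.mul_sum]
    rw [Finset.sum_comm]
    simp only [mul_left_comm]
    ring

theorem sum_Icc_one_eq_sum_range (f : ℕ → ℝ) (n : ℕ) :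
    ∑ k ∈ Finset.Icc 1 n, f k = ∑ k ∈ Finset.range n, f (k + 1) := by
  induction n with
  | zero => simp
  | succ n ih => rw [Finset.sum_Icc_succ_top (by omega), ih, Finset.sum_range_succ]

theorem isStationaryAR_limCov {p : ℕ} {θ : Fin p → ℝ} {ρ σ : ℝ} (x e v : quadMean)
    (hx : ∀ n : ℕ, x.1 (n + 1) = ∑ i, θ i * x.1 ((n : ℤ) - i) + e.1 (n + 1))
    (he : ∀ n : ℕ, e.1 (n + 1) = ρ * e.1 n + v.1 (n + 1))
    (hv2 : Tendsto (timeAvg fun k => v.1 k ^ 2) atTop (𝓝 (σ ^ 2)))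
    (hvj : ∀ j : ℕ, 0 < j → Tendsto (timeAvg fun k => v.1 (k + j) * v.1 k) atTop (𝓝 0))
    (𝒰 : Ultrafilter ℕ) (h𝒰 : (𝒰 : Filter ℕ) ≤ atTop) :
    IsStationaryAR θ ρ σ (limCov 𝒰) (fun j => lagSeq j x) (fun j => lagSeq j e)
      (fun j => lagSeq j v) where
  symm := limCov_comm 𝒰
  nonneg := limCov_self_nonneg 𝒰
  shift_x m i j := by rw [lagSeq_add, lagSeq_add, limCov_lag 𝒰 h𝒰]
  shift_e m i j := by rw [lagSeq_add, lagSeq_add, limCov_lag 𝒰 h𝒰]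
  shift_vx m i j := by rw [lagSeq_add, lagSeq_add, limCov_lag 𝒰 h𝒰]
  var_v := by
    refine tendsto_nhds_unique (tendsto_limCov 𝒰 _ _) ?_
    simpa [lagSeq, sq] using hv2.mono_left h𝒰
  orth_v j hj := by
    lift j to ℕ using hj.le
    -- Shifting by `-j` turns the product into `v k * v (k + j)`.
    rw [← limCov_lag 𝒰 h𝒰 (-j), ← lagSeq_add, ← lagSeq_add]
    refine tendsto_nhds_unique (tendsto_limCov 𝒰 _ _) ?_
    simpa [lagSeq] using (hvj j (by exact_mod_cast hj)).mono_left h𝒰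
  rec_x j g := by
    rw [limCov_congr 𝒰 h𝒰 (lagSeq j x) (∑ i : Fin p, θ i • lagSeq (j + i + 1) x + lagSeq j e) g
      j.toNat]
    · simp
    · intro k hk
      -- The lagged recursion holds only for `k > j`; the finitely many other positive times do not
      -- affect `limCov`.
      obtain ⟨n, hn⟩ : ∃ n : ℕ, k - j = n + 1 := ⟨(k - j - 1).toNat, by omega⟩
      have hn' : ∀ i : Fin p, k - (j + i + 1) = n - i := fun i => by omega
      simp [lagSeq, hn, hx, hn']
  rec_e j g := by
    rw [limCov_congr 𝒰 h𝒰 (lagSeq j e) (ρ • lagSeq (j + 1) e + lagSeq j v) g j.toNat]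
    · simp
    · intro k hk
      obtain ⟨n, hn⟩ : ∃ n : ℕ, k - j = n + 1 := ⟨(k - j - 1).toNat, by omega⟩
      have hn' : k - (j + 1) = n := by omega
      simp [lagSeq, hn, he, hn']

theorem tendsto_smul_designMatrix {p : ℕ} (S : Matrix (Fin p) (Fin p) ℝ) (x : quadMean)
    (𝒰 : Ultrafilter ℕ) (h𝒰 : (𝒰 : Filter ℕ) ≤ atTop) :
    Tendsto (fun n : ℕ => (n : ℝ)⁻¹ • designMatrix S x.1 (n - 1)) 𝒰
      (𝓝 (Matrix.of fun i j : Fin p => limCov 𝒰 (lagSeq (i + 1) x) (lagSeq (j + 1) x))) := by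
  refine tendsto_pi_nhds.mpr fun i => tendsto_pi_nhds.mpr fun j => ?_
  have h := (tendsto_limCov 𝒰 (lagSeq (i + 1) x) (lagSeq (j + 1) x)).add
    ((tendsto_const_div_atTop_nhds_zero_nat (S i j)).mono_left h𝒰)
  rw [add_zero] at h
  refine h.congr' ?_
  filter_upwards [h𝒰 (eventually_gt_atTop 0)] with n hn
  rw [designMatrix, Nat.sub_add_cancel hn]
  simp only [Matrix.smul_apply, Matrix.add_apply, Matrix.sum_apply, vecMulVec_apply, lagVec,
    smul_eq_mul, timeAvg, lagSeq, add_sub_add_right_eq_sub]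
  ring

theorem tendsto_thetaHat {p : ℕ} (S : Matrix (Fin p) (Fin p) ℝ) (x : quadMean)
    (𝒰 : Ultrafilter ℕ) (h𝒰 : (𝒰 : Filter ℕ) ≤ atTop) (b : Fin p → ℝ)
    (hdet : IsUnit (Matrix.of fun i j : Fin p =>
      limCov 𝒰 (lagSeq (i + 1) x) (lagSeq (j + 1) x)).det)
    (hb : ∀ i : Fin p, ∑ j : Fin p, limCov 𝒰 (lagSeq (i + 1) x) (lagSeq (j + 1) x) * b j =
      limCov 𝒰 (lagSeq 0 x) (lagSeq (i + 1) x)) :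
    Tendsto (fun n : ℕ => thetaHat S x.1 n) 𝒰 (𝓝 b) := by
  set Γ : Matrix (Fin p) (Fin p) ℝ := Matrix.of fun i j : Fin p =>
    limCov 𝒰 (lagSeq (i + 1) x) (lagSeq (j + 1) x) with hΓ
  set γ : Fin p → ℝ := fun i => limCov 𝒰 (lagSeq 0 x) (lagSeq (i + 1) x) with hγ
  have hinv : Tendsto (fun n : ℕ => ((n : ℝ)⁻¹ • designMatrix S x.1 (n - 1))⁻¹) 𝒰 (𝓝 Γ⁻¹) := by
    refine Tendsto.comp (g := Inv.inv) (continuousAt_matrix_inv Γ ?_)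
      (tendsto_smul_designMatrix S x 𝒰 h𝒰)
    rw [Ring.inverse_eq_inv']
    exact continuousAt_inv₀ hdet.ne_zero
  have hvec : Tendsto (fun n : ℕ => (n : ℝ)⁻¹ •
      ∑ k ∈ Finset.Icc 1 n, x.1 (k : ℤ) • lagVec p x.1 ((k : ℤ) - 1)) 𝒰 (𝓝 γ) := by
    refine tendsto_pi_nhds.mpr fun i => ?_
    refine (tendsto_limCov 𝒰 (lagSeq 0 x) (lagSeq (i + 1) x)).congr fun n => ?_
    simp only [Pi.smul_apply, Finset.sum_apply, lagVec, smul_eq_mul, sum_Icc_one_eq_sum_range,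
      timeAvg, lagSeq]
    rw [div_eq_inv_mul]
    congr 1
    refine Finset.sum_congr rfl fun k _ => ?_
    push_cast
    rw [sub_zero, sub_sub, add_comm (1 : ℤ)]
  have hbΓ : b = Γ⁻¹ *ᵥ γ := by
    have h1 : Γ *ᵥ b = γ := funext hb
    rw [← h1, mulVec_mulVec, nonsing_inv_mul _ hdet, one_mulVec]
  have hmul : Continuous fun q : Matrix (Fin p) (Fin p) ℝ × (Fin p → ℝ) => q.1 *ᵥ q.2 :=
    continuous_fst.matrix_mulVec continuous_snd
  rw [hbΓ]
  refine ((hmul.tendsto (Γ⁻¹, γ)).comp (hinv.prodMk_nhds hvec)).congr' ?_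
  filter_upwards [h𝒰 (eventually_gt_atTop 0)] with n hn
  have hn' : (n : ℝ) ≠ 0 := by exact_mod_cast hn.ne'
  simp only [Function.comp_apply, thetaHat]
  have hsm : ((n : ℝ)⁻¹ • designMatrix S x.1 (n - 1))⁻¹
      = (n : ℝ) • (designMatrix S x.1 (n - 1))⁻¹ := by
    by_cases hu : IsUnit (designMatrix S x.1 (n - 1)).det
    · have := inv_smul' (designMatrix S x.1 (n - 1)) (Units.mk0 (n : ℝ) hn')⁻¹ hu
      simpa [Units.smul_def] using this
    -- In the singular case both inverses are `0` by convention.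
    · rw [nonsing_inv_apply_not_isUnit _ hu, nonsing_inv_apply_not_isUnit, smul_zero]
      rw [det_smul, isUnit_iff_ne_zero, not_not]
      rw [isUnit_iff_ne_zero, not_not] at hu
      rw [hu, mul_zero]
  rw [hsm, smul_mulVec, mulVec_smul, smul_smul, mul_inv_cancel₀ hn', one_smul]

/-- The convention `ε̂_0 = X_0` agrees with the general formula because the values at times `-1, …,
-p` vanish. -/
theorem estResidual_eq {p : ℕ} (S : Matrix (Fin p) (Fin p) ℝ) (x : ℤ → ℝ)
    (hx : ∀ j : ℕ, 1 ≤ j → j ≤ p → x (-(j : ℤ)) = 0) (n k : ℕ) :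
    estResidual S x n k = x k - ∑ i, thetaHat S x n i * x (k - (i + 1)) := by
  rcases Nat.eq_zero_or_pos k with rfl | hk
  · rw [estResidual, if_pos rfl, Finset.sum_eq_zero fun i _ => ?_]
    · simp
    · have := hx (i + 1) (by omega) (by omega)
      push_cast at this
      rw [Nat.cast_zero, zero_sub, this, mul_zero]
  · rw [estResidual, if_neg hk.ne']
    simp only [dotProduct, lagVec, sub_sub, add_comm (1 : ℤ)]

theorem tendsto_rhoHat {p : ℕ} {θ : Fin p → ℝ} {ρ σ : ℝ} (hp : 0 < p)
    (hθ : ∑ i, |θ i| < 1) (hρ : |ρ| < 1) (hσ : 0 < σ)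
    (x e v : ℤ → ℝ) (hx0 : ∀ j : ℕ, 1 ≤ j → j ≤ p → x (-(j : ℤ)) = 0)
    (hx : ∀ n : ℕ, x (n + 1) = ∑ i, θ i * x ((n : ℤ) - i) + e (n + 1))
    (he : ∀ n : ℕ, e (n + 1) = ρ * e n + v (n + 1))
    (hv2 : Tendsto (timeAvg fun k => v k ^ 2) atTop (𝓝 (σ ^ 2)))
    (hvj : ∀ j : ℕ, 0 < j → Tendsto (timeAvg fun k => v (k + j) * v k) atTop (𝓝 0))
    (S : Matrix (Fin p) (Fin p) ℝ) :
    Tendsto (fun n : ℕ => rhoHat S x n) atTop (𝓝 (rhoStar hp θ ρ)) := by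
  have hvq : v ∈ quadMean := quadMean_of_tendsto_timeAvg_sq hv2
  have heq : e ∈ quadMean := quadMean_of_recursion (fun _ : Fin 1 => ρ) (by simpa using hρ) e v hvq
    (by simpa using he)
  have hxq : x ∈ quadMean := quadMean_of_recursion θ hθ x e heq hx
  rw [tendsto_iff_ultrafilter]
  intro 𝒰 h𝒰
  lift x to quadMean using hxq
  have hAR := isStationaryAR_limCov (θ := θ) (ρ := ρ) (σ := σ) x ⟨e, heq⟩ ⟨v, hvq⟩ hx he hv2
    hvj 𝒰 h𝒰
  have hdet : IsUnit (Matrix.of fun i j : Fin p =>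
      limCov 𝒰 (lagSeq (i + 1) x) (lagSeq (j + 1) x)).det := by
    rw [isUnit_iff_ne_zero]
    intro h0
    obtain ⟨a, ha, ha0⟩ := exists_mulVec_eq_zero_iff.mpr h0
    exact ha (hAR.eq_zero_of_mulVec_eq_zero hθ hρ hσ a fun i => congrFun ha0 i)
  have hθhat := tendsto_thetaHat S x 𝒰 h𝒰 (thetaStar hp θ ρ) hdet fun i => by
    rw [← hAR.yule_walker hp hθ hρ i]
    refine Finset.sum_congr rfl fun j _ => ?_
    rw [limCov_comm, mul_comm]
  have hnum := tendsto_timeAvg_residual_mul 𝒰 _ _ hθhat (lagSeq 0 x) (lagSeq 1 x)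
    (fun i => lagSeq (i + 1) x) (fun i => lagSeq (i + 1 + 1) x)
  -- The denominator sums `ε̂_{k-1}²`, hence lag `1` in both factors; stationarity brings it back to
  -- lag `0`.
  have hden := tendsto_timeAvg_residual_mul 𝒰 _ _ hθhat (lagSeq 1 x) (lagSeq 1 x)
    (fun i => lagSeq (i + 1 + 1) x) (fun i => lagSeq (i + 1 + 1) x)
  have hpos := hAR.le_residual_var hp hθ hρ
  rw [hAR.residual_cov_succ hp hθ hρ] at hnum
  rw [hAR.residual_var_shift] at hden
  set D := limCov 𝒰 (lagSeq 0 x - ∑ j : Fin p, thetaStar hp θ ρ j • lagSeq (j + 1) x)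
    (lagSeq 0 x - ∑ j : Fin p, thetaStar hp θ ρ j • lagSeq (j + 1) x) with hD
  have hD0 : D ≠ 0 := by
    have : 0 < σ ^ 2 := by positivity
    linarith
  have hlim := (hden.inv₀ hD0).mul hnum
  rw [mul_comm (rhoStar hp θ ρ), inv_mul_cancel_left₀ hD0] at hlim
  refine hlim.congr' ?_
  filter_upwards [h𝒰 (eventually_gt_atTop 0)] with n hn
  have hn' : (n : ℝ) ≠ 0 := by exact_mod_cast hn.ne'
  rw [rhoHat, sum_Icc_one_eq_sum_range, sum_Icc_one_eq_sum_range]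
  simp only [estResidual_eq S x.1 hx0, Nat.add_sub_cancel, timeAvg, lagSeq]
  rw [inv_div, div_mul_div_comm, mul_comm (n : ℝ), mul_div_mul_right _ _ hn', div_eq_inv_mul]
  have e1 : ∀ (k : ℤ) (i : Fin p), k + 1 - (i + 1 + 1) = k - (i + 1) := fun k i => by ring
  simp [e1, sq]

theorem mainTheorem6
    {Ω : Type*} [MeasurableSpace Ω] (μ : Measure Ω) [IsProbabilityMeasure μ]
    (p : ℕ) (hp : 0 < p)
    -- parameters and stability conditions
    (θ : Fin p → ℝ) (hθ_ne : θ ≠ 0) (hθ : ∑ i, |θ i| < 1)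
    (ρ : ℝ) (hρ : |ρ| < 1)
    -- the driving noise `V_1, V_2, …`: square-integrable, i.i.d., centred, variance `σ² > 0`
    (σ : ℝ) (hσ : 0 < σ)
    (V : ℕ → Ω → ℝ)
    (hV_meas : ∀ n, 1 ≤ n → Measurable (V n))
    (hV_sq : ∀ n, 1 ≤ n → MemLp (V n) 2 μ)
    (hV_indep : iIndepFun (fun n : ℕ => V (n + 1)) μ)
    (hV_ident : ∀ n, 1 ≤ n → IdentDistrib (V n) (V 1) μ μ)
    (hV_mean : ∀ n, 1 ≤ n → ∫ ω, V n ω ∂μ = 0)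
    (hV_var : ∀ n, 1 ≤ n → variance (V n) μ = σ ^ 2)
    -- the processes `(X_n)`, `n ≥ -p`, and `(ε_n)`, `n ≥ 0`
    (X : ℤ → Ω → ℝ) (ε : ℕ → Ω → ℝ)
    (hX0_meas : Measurable (X 0)) (hX0_sq : MemLp (X 0) 2 μ)
    (h_init : ∀ ω, X 0 ω = ε 0 ω)
    (hX_neg : ∀ j : ℕ, 1 ≤ j → j ≤ p → ∀ ω, X (-(j : ℤ)) ω = 0)
    (hX : ∀ n : ℕ, 1 ≤ n → ∀ ω,
      X n ω = ∑ i : Fin p, θ i * X ((n : ℤ) - ((i : ℤ) + 1)) ω + ε n ω)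
    (hε : ∀ n : ℕ, 1 ≤ n → ∀ ω, ε n ω = ρ * ε (n - 1) ω + V n ω)
    -- the deterministic symmetric positive definite matrix added in `S_n`
    (S : Matrix (Fin p) (Fin p) ℝ) (hS : S.PosDef) :
    ∀ᵐ ω ∂μ, Tendsto (fun n : ℕ => rhoHat S (fun k => X k ω) n) atTop
      (𝓝 (rhoStar hp θ ρ)) := by
  have h1 := ae_tendsto_average_sq (W := fun n => V (n + 1)) (fun n => hV_meas _ (by omega))
    (fun n => hV_sq _ (by omega)) hV_indep (fun n => hV_ident _ (by omega))
    (fun n => hV_mean _ (by omega)) (fun n => hV_var _ (by omega))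
  have h2 : ∀ j : ℕ, 0 < j → _ := fun j hj => ae_tendsto_average_mul_lag
    (W := fun n => V (n + 1)) (fun n => hV_meas _ (by omega))
    (fun n => hV_sq _ (by omega)) hV_indep (fun n => hV_ident _ (by omega))
    (fun n => hV_mean _ (by omega)) j hj
  filter_upwards [h1, ae_all_iff.mpr fun j => ae_all_iff.mpr (h2 j)] with ω hω1 hω2
  -- Extending `ε` and `V` by `Int.toNat` is harmless at negative times: the recursions and averages
  -- only concern positive ones.
  refine tendsto_rhoHat hp hθ hρ hσ (fun k => X k ω) (fun k => ε k.toNat ω)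
    (fun k => V k.toNat ω) (fun j hj hjp => hX_neg j hj hjp ω) (fun n => ?_) (fun n => ?_)
    hω1 (fun j hj => ?_) S
  · have := hX (n + 1) (by omega) ω
    push_cast at this
    simp only [add_sub_add_right_eq_sub] at this
    exact this
  · exact hε (n + 1) (by omega) ω
  · refine (hω2 j hj).congr fun n => ?_
    simp only [timeAvg]
    congr 1
    refine Finset.sum_congr rfl fun k _ => ?_
    rw [show ((k : ℤ) + 1 + j).toNat = k + j + 1 by omega]
    rfl
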